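/- **Setting.** Fix $p\ge 1$, a quantile level $\tau\in(0,1)$ and an integer $K^*\ge 0$. For every sample size $n$ (large enough) let $$Y_i=\mathbf x_i^\top\beta^*_i+\varepsilon_i,\qquad i=1,\dots,n,$$ with deterministic $\mathbf x_i,\beta_i^*\in\mathbb R^p$ (both may depend on $n$), where the first component of every $\mathbf x_i$ is a constant $c^{(0)}\neq 0$ independent of $n$ and $i$. For $\beta=(\beta_1,\dots,\beta_n)$ call $i\in\{2,\dots,n\}$ a change-point of $\beta$ if $\beta_i\ne\beta_{i-1}$. Let $t_1^*<\dots<t^*_{K^*}$ be the change-points of $\beta^*$, $t_0^*=1$, $t^*_{K^*+1}=n$, let $\Delta_k=\beta^*_{t_k^*}-\beta^*_{t_k^*-1}$ (the jump $\phi^*_{k+1}-\phi^*_k$ of the coefficients at $t_k^*$) and $I^*_{min}=\min_{0\le k\le K^*}(t^*_{k+1}-t^*_k)$. Let $\rho_\tau(u)=u(\tau-\mathbf 1_{\{u<0\}})$ and let $\check\beta^n$ be any quantile fused group-LASSO estimator, that is, (almost surely) a minimizer over $(\mathbb R^p)^n$ of $$R(\beta)=\sum_{i=1}^n\rho_\tau(Y_i-\mathbf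 x_i^\top\beta_i)+n\lambda_n\sum_{i=2}^n\|\beta_i-\beta_{i-1}\| .$$ Let $\check{\mathcal A}_n=\{\check t_1<\check t_2<\cdots\}$ be its set of change-points. **Assumptions** (for all $n$ from some $N$ on; all constants independent of $n$). * (A1) $\max_{1\le i\le n}\|\mathbf x_i\|\le c^{(1)}$ for a constant $0<c^{(1)}<1$. * (A2) The $\varepsilon_i$ are i.i.d. with a bounded density and a distribution function $F$ with $F(u)>0$ for all $u\in\mathbb R$; $\mathbb P[\varepsilon<0]=\tau$; and $0$ is the only $\tau$-quantile, i.e. $F(u)=\tau$ only for $u=0$. * (A3) There are $0<m_0\le M_0<\infty$ such that for all $1\le n_1<n_2\le n$ with $n_2-n_1\ge n\delta_n/2$ all eigenvalues of $(n_2-n_1)^{-1}\sum_{i=n_1}^{n_2-1}\mathbf x_i\mathbf x_i^\top$ lie in $[m_0,M_0]$. * (A4) $I^*_{min}\ge n\delta_n$, where $(\delta_n)$ is decreasing, $\delta_n\to0$ and $(\log n)^{-1}n\delta_n\to\infty$. * (A5) There are constants $0<c^{(a)},c^{(b)}<\infty$ with $c^{(b)}<\|\Delta_k\|<c^{(a)}$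 for $1\le k\le K^*$. * (A6) $K^*$ does not depend on $n$. * (A7) $\delta_n,\lambda_n>0$, $n\lambda_n\to\infty$ and $\lambda_n/\delta_n\to0$. * (A8) For $k=1,\dots,K^*$ the limit $L_k=\lim_{n\to\infty}(n\delta_n)^{-1}\sum_{i=t_k^*-[n\delta_n]}^{t_k^*-1}F(\mathbf x_i^\top\Delta_k)$ exists and $L_k\ne\tau$. **Theorem.** Under (A1)–(A8), if the estimator detects exactly $K^*$ change-points, then with probability tending to one each of them is within $n\delta_n$ of the corresponding true one: $$\lim_{n\to\infty}\mathbb P\Big[\,|\check{\mathcal A}_n|=K^*\ \text{ and }\ \max_{1\le k\le K^*}|\check t_k-t_k^*|>n\delta_n\Big]=0 .$$ In particular, if $\mathbb P[|\check{\mathcal A}_n|=K^*]\to1$, then $\lim_{n\to\infty}\mathbb P\big[\max_{1\le k\le K^*}|\check t_k-t_k^*|\le n\delta_n\big]=1$. -/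

import Mathlib

open Filter Topology MeasureTheory ProbabilityTheory

noncomputable section

namespace QuantileFused

/-- The check function `ρ_τ(u) = u (τ - 1_{u < 0})`. -/
def check (τ u : ℝ) : ℝ := u * (τ - if u < 0 then 1 else 0)

variable {p : ℕ}

/-- The objective function of the quantile fused group LASSO,
`R(β) = ∑_{i=1}^n ρ_τ(Y_i - x_iᵀ β_i) + n λ ∑_{i=2}^n ‖β_i - β_{i-1}‖`.
Observations are indexed by `1, …, n`; a parameter vector `(β_1, …, β_n)` is given as a sequence
of which only the entries `1, …, n` matter. -/
def objective (τ lam : ℝ) (n : ℕ) (x : ℕ → EuclideanSpace ℝ (Fin p)) (Y : ℕ → ℝ)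
    (β : ℕ → EuclideanSpace ℝ (Fin p)) : ℝ :=
  ∑ i ∈ Finset.Icc 1 n, check τ (Y i - inner ℝ (x i) (β i))
    + n * lam * ∑ i ∈ Finset.Icc 2 n, ‖β i - β (i - 1)‖

/-- `β` is a quantile fused group LASSO estimate: a minimizer of the objective function. -/
def IsEstimate (τ lam : ℝ) (n : ℕ) (x : ℕ → EuclideanSpace ℝ (Fin p)) (Y : ℕ → ℝ)
    (β : ℕ → EuclideanSpace ℝ (Fin p)) : Prop :=
  ∀ b : ℕ → EuclideanSpace ℝ (Fin p), objective τ lam n x Y β ≤ objective τ lam n x Y b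

open Classical in
/-- The set of change-points `{i ∈ {2, …, n} : β_i ≠ β_{i-1}}` of `(β_1, …, β_n)`. -/
def changePoints (n : ℕ) (β : ℕ → EuclideanSpace ℝ (Fin p)) : Finset ℕ :=
  (Finset.Icc 2 n).filter fun i => β i ≠ β (i - 1)

/-- The change-points in increasing order: `cpt n β k = t_k` for `1 ≤ k ≤ K`, where `K` is the
number of change-points, with the conventions `t_0 = 1` and `t_k = n` for `k > K`. -/
def cpt (n : ℕ) (β : ℕ → EuclideanSpace ℝ (Fin p)) (k : ℕ) : ℕ :=
  (1 :: (changePoints n β).sort).getD k n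

/-- The jump `φ_{k+1} - φ_k` of the coefficients at the `k`-th change-point. -/
def jump (n : ℕ) (β : ℕ → EuclideanSpace ℝ (Fin p)) (k : ℕ) : EuclideanSpace ℝ (Fin p) :=
  β (cpt n β k) - β (cpt n β k - 1)

/-- The minimal distance `I_min = min_{0 ≤ k ≤ K} (t_{k+1} - t_k)` between consecutive
change-points, where `t_0 = 1` and `t_{K+1} = n`. -/
def minGap (n : ℕ) (β : ℕ → EuclideanSpace ℝ (Fin p)) : ℝ :=
  (Finset.range ((changePoints n β).card + 1)).inf' Finset.nonempty_range_add_one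
    fun k => (cpt n β (k + 1) : ℝ) - cpt n β k

/-- The averaged Gram matrix `(n₂ - n₁)⁻¹ ∑_{i=n₁}^{n₂-1} x_i x_iᵀ`. -/
def gram (x : ℕ → EuclideanSpace ℝ (Fin p)) (n₁ n₂ : ℕ) : Matrix (Fin p) (Fin p) ℝ :=
  ((n₂ : ℝ) - n₁)⁻¹ • ∑ i ∈ Finset.Ico n₁ n₂, Matrix.vecMulVec (x i) (x i)

/-- Assumptions on the design, for all sample sizes `n ≥ N`: the first component is a nonzero
constant, the norms are bounded by some `c < 1`, and the eigenvalues of the averaged Gram matrices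
over all blocks of length at least `n δ_n / 2` lie in a fixed interval `[m, M]` with `m > 0`. -/
structure DesignAssumptions [NeZero p] (N : ℕ) (x : ℕ → ℕ → EuclideanSpace ℝ (Fin p))
    (δ : ℕ → ℝ) : Prop where
  intercept : ∃ c : ℝ, c ≠ 0 ∧ ∀ n ≥ N, ∀ i ∈ Finset.Icc 1 n, x n i 0 = c
  bounded : ∃ c : ℝ, 0 < c ∧ c < 1 ∧ ∀ n ≥ N, ∀ i ∈ Finset.Icc 1 n, ‖x n i‖ ≤ c
  eigenvalues : ∃ m M : ℝ, 0 < m ∧ m ≤ M ∧ ∀ n ≥ N, ∀ n₁ n₂ : ℕ, 1 ≤ n₁ → n₁ < n₂ → n₂ ≤ n →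
    n * δ n / 2 ≤ (n₂ : ℝ) - n₁ → ∀ μ ∈ spectrum ℝ (gram (x n) n₁ n₂), m ≤ μ ∧ μ ≤ M

/-- Assumptions on the law `ν` of an error `ε`: it has a bounded density, its distribution
function `F` is positive, `P(ε < 0) = τ`, and `0` is the only `τ`-quantile. -/
structure ErrorAssumptions (τ : ℝ) (ν : Measure ℝ) : Prop where
  density : ∃ f : ℝ → ℝ, Measurable f ∧ (∀ u, 0 ≤ f u) ∧ (∃ C, ∀ u, f u ≤ C) ∧
    ν = volume.withDensity fun u => ENNReal.ofReal (f u)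
  cdf_pos : ∀ u, 0 < cdf ν u
  quantile : ν.real (Set.Iio 0) = τ
  quantile_unique : ∀ u, cdf ν u = τ → u = 0

/-- Assumptions on the positive sequences `δ_n` and `λ_n`. -/
structure RateAssumptions (N : ℕ) (δ lam : ℕ → ℝ) : Prop where
  delta_pos : ∀ n ≥ N, 0 < δ n
  lam_pos : ∀ n ≥ N, 0 < lam n
  delta_decreasing : AntitoneOn δ (Set.Ici N)
  delta_tendsto : Tendsto δ atTop (𝓝 0)
  delta_log : Tendsto (fun n : ℕ => (Real.log n)⁻¹ * (n * δ n)) atTop atTop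
  lam_tendsto : Tendsto (fun n : ℕ => n * lam n) atTop atTop
  lam_delta : Tendsto (fun n : ℕ => lam n / δ n) atTop (𝓝 0)

/-- Assumptions on the true coefficients `β n = (β_1, …, β_n)` at sample size `n`: exactly `K`
change-points, at mutual distances at least `n δ_n`, with jumps that are bounded and bounded away
from zero, and such that, for every `k`, the averages of `F(x_iᵀ (φ_{k+1} - φ_k))` over the
`[n δ_n]` observations before the `k`-th change-point have a limit different from `τ`. -/
structure ChangeAssumptions (N K : ℕ) (τ : ℝ) (ν : Measure ℝ)
    (x : ℕ → ℕ → EuclideanSpace ℝ (Fin p)) (δ : ℕ → ℝ)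
    (β : ℕ → ℕ → EuclideanSpace ℝ (Fin p)) : Prop where
  card : ∀ n ≥ N, (changePoints n (β n)).card = K
  gap : ∀ n ≥ N, n * δ n ≤ minGap n (β n)
  jump_bounded : ∃ c : ℝ, 0 < c ∧ ∀ n ≥ N, ∀ k ∈ Finset.Icc 1 K, ‖jump n (β n) k‖ < c
  jump_large : ∃ c : ℝ, 0 < c ∧ ∀ n ≥ N, ∀ k ∈ Finset.Icc 1 K, c < ‖jump n (β n) k‖
  limit : ∀ k ∈ Finset.Icc 1 K, ∃ L : ℝ, L ≠ τ ∧
    Tendsto (fun n : ℕ => (n * δ n)⁻¹ *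
      ∑ i ∈ Finset.Ico (cpt n (β n) k - ⌊n * δ n⌋₊) (cpt n (β n) k),
        cdf ν (inner ℝ (x n i) (jump n (β n) k))) atTop (𝓝 L)

end QuantileFused

end

namespace QuantileFused

/-! Around a true change-point, take the two blocks of length `w = ⌈n δ_n / 2⌉` just before and just
after it; each lies in a single true regime. If the estimate had no change-point closer than `w`, it
would take one value on both blocks. Replacing that value on one block by the true parameter changes
the penalty by at most `2 n λ_n` times their distance, so by convexity of the loss the value lies
within `η` of the true parameter as soon as the loss increase exceeds `2 n λ_n η` on the whole
sphere of radius `η` (`IsEstimate.norm_sub_lt`). With `η` half the lower bound on the jumps,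
closeness on both sides contradicts the triangle inequality (`IsEstimate.exists_mem_changePoints`).

The loss increase on a sphere is at least of order `w`, while `n λ_n` is negligible against `n δ_n`.
In expectation this follows from the uniqueness of the quantile and the Gram bound; a finite net of
the sphere and Chebyshev's inequality make it uniform outside an event of probability `O(1 / w)`
(`exists_measure_sphere_le`). There are `2 K` blocks, so a union bound suffices.

Finally, each of the `K` true change-points has an estimated one within less than half the minimal
gap; when there are exactly `K` estimated ones, this matching respects the order
(`abs_cpt_sub_cpt_lt`). -/

/-! ### The check function and its increments. -/

theorem check_eq_max (τ u : ℝ) : check τ u = max (τ * u) ((τ - 1) * u) := by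
  unfold check
  split_ifs with h
  · rw [max_eq_right (by linarith)]; ring
  · rw [max_eq_left (by linarith)]; ring

theorem abs_check_sub_le {τ : ℝ} (hτ : 0 < τ ∧ τ < 1) (u v : ℝ) :
    |check τ u - check τ v| ≤ |u - v| := by
  rw [check_eq_max, check_eq_max]
  refine (abs_max_sub_max_le_max _ _ _ _).trans (max_le ?_ ?_)
  · rw [← mul_sub, abs_mul, abs_of_pos hτ.1]
    exact mul_le_of_le_one_left (abs_nonneg _) hτ.2.le
  · rw [← mul_sub, abs_mul]
    refine mul_le_of_le_one_left (abs_nonneg _) ?_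
    rw [abs_le]; constructor <;> linarith

theorem continuous_check (τ : ℝ) : Continuous (check τ) := by
  have : check τ = fun u => max (τ * u) ((τ - 1) * u) := funext (check_eq_max τ)
  rw [this]; fun_prop

/-- Convexity along the segment from `u` to `u - a`. -/
theorem check_sub_mul_le (τ u a : ℝ) {s : ℝ} (hs0 : 0 ≤ s) (hs1 : s ≤ 1) :
    check τ (u - s * a) - check τ u ≤ s * (check τ (u - a) - check τ u) := by
  have h1 := le_max_left (τ * u) ((τ - 1) * u)
  have h2 := le_max_right (τ * u) ((τ - 1) * u)
  have h3 := le_max_left (τ * (u - a)) ((τ - 1) * (u - a))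
  have h4 := le_max_right (τ * (u - a)) ((τ - 1) * (u - a))
  simp only [← check_eq_max] at h1 h2 h3 h4
  rw [check_eq_max τ (u - s * a), sub_le_iff_le_add]
  refine max_le ?_ ?_ <;> nlinarith [mul_nonneg hs0 (sub_nonneg.2 h3),
    mul_nonneg hs0 (sub_nonneg.2 h4), mul_nonneg (sub_nonneg.2 hs1) (sub_nonneg.2 h1),
    mul_nonneg (sub_nonneg.2 hs1) (sub_nonneg.2 h2)]

/-- The increase of the check function when the residual `u` is shifted by `a`. -/
noncomputable def checkShift (τ a u : ℝ) : ℝ := check τ (u - a) - check τ u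

theorem abs_checkShift_le {τ : ℝ} (hτ : 0 < τ ∧ τ < 1) (a u : ℝ) : |checkShift τ a u| ≤ |a| := by
  simpa [checkShift] using abs_check_sub_le hτ (u - a) u

theorem abs_checkShift_sub_le {τ : ℝ} (hτ : 0 < τ ∧ τ < 1) (a b u : ℝ) :
    |checkShift τ a u - checkShift τ b u| ≤ |a - b| := by
  have := abs_check_sub_le hτ (u - a) (u - b)
  rw [show u - a - (u - b) = -(a - b) by ring, abs_neg] at this
  simpa [checkShift] using this

theorem measurable_checkShift (τ a : ℝ) : Measurable (checkShift τ a) := by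
  have := (continuous_check τ).measurable
  unfold checkShift
  fun_prop

theorem integrable_checkShift {τ : ℝ} (hτ : 0 < τ ∧ τ < 1) (a : ℝ) (ν : Measure ℝ)
    [IsProbabilityMeasure ν] : Integrable (checkShift τ a) ν :=
  Integrable.of_bound (measurable_checkShift τ a).aestronglyMeasurable |a|
    (ae_of_all _ fun u => abs_checkShift_le hτ a u)

/-! ### Expected increments under the error law. -/

/-- The subgradient term `-a (τ - 1_{u < 0})` has mean zero because `ν (-∞, 0) = τ`; only the excess
over the tangent on `S` survives integration. -/
theorem mul_measureReal_le_integral_checkShift {τ : ℝ} (hτ : 0 < τ ∧ τ < 1) (ν : Measure ℝ)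
    [IsProbabilityMeasure ν] (hν : ν.real (Set.Iio 0) = τ) {a d : ℝ} {S : Set ℝ}
    (hS : MeasurableSet S)
    (h : ∀ u, -a * (τ - (Set.Iio 0).indicator 1 u) + d * S.indicator 1 u ≤ checkShift τ a u) :
    d * ν.real S ≤ ∫ u, checkShift τ a u ∂ν := by
  have i1 : Integrable ((Set.Iio (0 : ℝ)).indicator (1 : ℝ → ℝ)) ν :=
    (integrable_const (1 : ℝ)).indicator measurableSet_Iio
  have i2 : Integrable (S.indicator (1 : ℝ → ℝ)) ν := (integrable_const (1 : ℝ)).indicator hS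
  have i3 : Integrable (fun u => -a * (τ - (Set.Iio (0 : ℝ)).indicator (1 : ℝ → ℝ) u)) ν :=
    ((integrable_const τ).sub i1).const_mul _
  have := integral_mono (i3.add (i2.const_mul d)) (integrable_checkShift hτ a ν) h
  refine le_trans (le_of_eq ?_) this
  simp only [Pi.add_apply]
  rw [integral_add i3 (i2.const_mul d), integral_const_mul, integral_const_mul,
    integral_sub (integrable_const τ) i1, integral_indicator_one measurableSet_Iio,
    integral_indicator_one hS, hν]
  simp

theorem integral_checkShift_nonneg {τ : ℝ} (hτ : 0 < τ ∧ τ < 1) (ν : Measure ℝ)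
    [IsProbabilityMeasure ν] (hν : ν.real (Set.Iio 0) = τ) (a : ℝ) :
    0 ≤ ∫ u, checkShift τ a u ∂ν := by
  have := mul_measureReal_le_integral_checkShift hτ ν hν (a := a) (d := 0) (S := ∅)
    MeasurableSet.empty (fun u => by
      simp only [checkShift, check, Set.indicator, Set.mem_Iio, Pi.one_apply]
      split_ifs <;> linarith)
  simpa using this

/-- For `0 ≤ u ≤ c` the shifted residual crosses zero, and the excess over the tangent is `a - u ≥
c`. The next lemma is the mirror image. -/
theorem le_integral_checkShift_of_two_mul_le {τ : ℝ} (hτ : 0 < τ ∧ τ < 1) (ν : Measure ℝ)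
    [IsProbabilityMeasure ν] (hν : ν.real (Set.Iio 0) = τ) {a c : ℝ} (hc : 0 < c)
    (ha : 2 * c ≤ a) : c * ν.real (Set.Icc 0 c) ≤ ∫ u, checkShift τ a u ∂ν := by
  refine mul_measureReal_le_integral_checkShift hτ ν hν measurableSet_Icc fun u => ?_
  simp only [checkShift, check, Set.indicator, Set.mem_Iio, Pi.one_apply, Set.mem_Icc]
  split_ifs <;> grind

theorem le_integral_checkShift_of_le_neg_two_mul {τ : ℝ} (hτ : 0 < τ ∧ τ < 1) (ν : Measure ℝ)
    [IsProbabilityMeasure ν] (hν : ν.real (Set.Iio 0) = τ) {a c : ℝ} (hc : 0 < c)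
    (ha : a ≤ -(2 * c)) : c * ν.real (Set.Ioo (-c) 0) ≤ ∫ u, checkShift τ a u ∂ν := by
  refine mul_measureReal_le_integral_checkShift hτ ν hν measurableSet_Ioo fun u => ?_
  simp only [checkShift, check, Set.indicator, Set.mem_Iio, Pi.one_apply, Set.mem_Ioo]
  split_ifs <;> grind

/-- Without mass on `[0, c]` the point `c` would be a second `τ`-quantile. -/
theorem ErrorAssumptions.measureReal_Icc_pos {τ : ℝ} {ν : Measure ℝ} [IsProbabilityMeasure ν]
    (h : ErrorAssumptions τ ν) {c : ℝ} (hc : 0 < c) : 0 < ν.real (Set.Icc 0 c) := by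
  refine lt_of_le_of_ne measureReal_nonneg fun h0 => hc.ne' (h.quantile_unique c ?_)
  rw [cdf_eq_real, ← Set.Iio_union_Icc_eq_Iic hc.le, measureReal_union _ measurableSet_Icc,
    ← h0, h.quantile, add_zero]
  rw [Set.disjoint_left]; intro y hy hy'
  exact absurd hy'.1 (not_le.2 hy)

theorem ErrorAssumptions.measureReal_Ioo_pos {τ : ℝ} {ν : Measure ℝ} [IsProbabilityMeasure ν]
    (h : ErrorAssumptions τ ν) {c : ℝ} (hc : 0 < c) : 0 < ν.real (Set.Ioo (-c) 0) := by
  refine lt_of_le_of_ne measureReal_nonneg fun h0 =>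
    (neg_lt_zero.2 hc).ne (h.quantile_unique (-c) ?_)
  have h1 : ν.real (Set.Iic (-c) ∪ Set.Ioo (-c) 0) = τ := by
    rw [Set.Iic_union_Ioo_eq_Iio (neg_lt_zero.2 hc), h.quantile]
  rw [measureReal_union _ measurableSet_Ioo, ← h0, add_zero] at h1
  · rw [cdf_eq_real, h1]
  · rw [Set.disjoint_left]; intro y hy hy'
    exact absurd hy'.1 (not_lt.2 hy)

/-- The expected increase of the check function grows at least quadratically, up to a small
additive error. -/
theorem ErrorAssumptions.exists_quadratic_le {τ : ℝ} (hτ : 0 < τ ∧ τ < 1) {ν : Measure ℝ}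
    [IsProbabilityMeasure ν] (h : ErrorAssumptions τ ν) {c η : ℝ} (hc : 0 < c) (hη : 0 < η) :
    ∃ q, 0 < q ∧ ∀ a, |a| ≤ η →
      q * ((a ^ 2 - 4 * c ^ 2) / η ^ 2) ≤ ∫ u, checkShift τ a u ∂ν := by
  have q1 := h.measureReal_Icc_pos hc
  have q2 := h.measureReal_Ioo_pos hc
  refine ⟨c * min (ν.real (Set.Icc 0 c)) (ν.real (Set.Ioo (-c) 0)),
    mul_pos hc (lt_min q1 q2), fun a ha => ?_⟩
  have hq : 0 < c * min (ν.real (Set.Icc 0 c)) (ν.real (Set.Ioo (-c) 0)) :=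
    mul_pos hc (lt_min q1 q2)
  -- The normalised quadratic is at most 1 for `|a| ≤ η` and nonpositive for `|a| < 2c`, so a
  -- constant bound outside `(-2c, 2c)` and nonnegativity inside suffice.
  have hle : (a ^ 2 - 4 * c ^ 2) / η ^ 2 ≤ 1 := by
    rw [div_le_one (by positivity)]
    nlinarith [sq_abs a, abs_nonneg a]
  by_cases h1 : 2 * c ≤ a
  · refine le_trans ?_ (le_integral_checkShift_of_two_mul_le hτ ν h.quantile hc h1)
    exact (mul_le_of_le_one_right hq.le hle).trans
      (mul_le_mul_of_nonneg_left (min_le_left _ _) hc.le)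
  by_cases h2 : a ≤ -(2 * c)
  · refine le_trans ?_ (le_integral_checkShift_of_le_neg_two_mul hτ ν h.quantile hc h2)
    exact (mul_le_of_le_one_right hq.le hle).trans
      (mul_le_mul_of_nonneg_left (min_le_right _ _) hc.le)
  · refine le_trans ?_ (integral_checkShift_nonneg hτ ν h.quantile a)
    refine mul_nonpos_of_nonneg_of_nonpos hq.le (div_nonpos_of_nonpos_of_nonneg ?_ (by positivity))
    push Not at h1 h2
    nlinarith

/-! ### Uniform lower bounds for the random loss increase. -/

section Concentration

variable {Ω : Type*} [MeasurableSpace Ω] {P : Measure Ω} [IsProbabilityMeasure P]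
  {ν : Measure ℝ} {ε : ℕ → Ω → ℝ} {τ : ℝ}

/-- Chebyshev's inequality for the increase of the loss over a finite set of observations. -/
theorem measure_sum_checkShift_le (hτ : 0 < τ ∧ τ < 1) (hmeas : ∀ i, Measurable (ε i))
    (hindep : iIndepFun ε P) (hlaw : ∀ i, P.map (ε i) = ν) (W : Finset ℕ) (hW : W.Nonempty)
    (a : ℕ → ℝ) {η κ : ℝ} (hκ : 0 < κ) (ha : ∀ i ∈ W, |a i| ≤ η)
    (hmean : 2 * κ * W.card ≤ ∑ i ∈ W, ∫ u, checkShift τ (a i) u ∂ν) :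
    P {ω | ∑ i ∈ W, checkShift τ (a i) (ε i ω) ≤ κ * W.card} ≤
      ENNReal.ofReal (η ^ 2 / κ ^ 2 / W.card) := by
  have hcard : (0 : ℝ) < W.card := by exact_mod_cast hW.card_pos
  let X : ℕ → Ω → ℝ := fun i ω => checkShift τ (a i) (ε i ω)
  have hXm : ∀ i, Measurable (X i) := fun i => (measurable_checkShift τ (a i)).comp (hmeas i)
  have hX2 : ∀ i, MemLp (X i) 2 P := fun i =>
    MemLp.of_bound (hXm i).aestronglyMeasurable |a i|
      (ae_of_all _ fun ω => abs_checkShift_le hτ _ _)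
  have hXi : iIndepFun X P := hindep.comp _ fun i => measurable_checkShift τ (a i)
  have hint : ∀ i, ∫ ω, X i ω ∂P = ∫ u, checkShift τ (a i) u ∂ν := fun i => by
    rw [← hlaw i, integral_map (hmeas i).aemeasurable
      (measurable_checkShift τ (a i)).aestronglyMeasurable]
  have hvar : variance (∑ i ∈ W, X i) P ≤ η ^ 2 * W.card := by
    rw [IndepFun.variance_sum (fun i _ => hX2 i) (fun i _ j _ hij => hXi.indepFun hij), mul_comm,
      ← nsmul_eq_mul]
    refine Finset.sum_le_card_nsmul _ _ _ fun i hi => ?_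
    refine (variance_le_expectation_sq (hXm i).aestronglyMeasurable).trans ?_
    have : ∀ ω, (X i ^ 2) ω ≤ η ^ 2 := fun ω => by
      simp only [Pi.pow_apply]
      rw [← sq_abs]
      exact pow_le_pow_left₀ (abs_nonneg _) ((abs_checkShift_le hτ _ _).trans (ha i hi)) 2
    calc ∫ ω, (X i ^ 2) ω ∂P ≤ ∫ _, η ^ 2 ∂P :=
          integral_mono (hX2 i).integrable_sq (integrable_const _) this
      _ = η ^ 2 := by simp
  have hmean' : 2 * κ * W.card ≤ ∫ ω, (∑ i ∈ W, X i) ω ∂P := by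
    simp only [Finset.sum_apply]
    rw [integral_finsetSum _ fun i _ => (hX2 i).integrable (by norm_num)]
    simpa only [hint] using hmean
  have hc := meas_ge_le_variance_div_sq (memLp_finsetSum' W fun i _ => hX2 i)
    (mul_pos hκ hcard)
  refine (measure_mono fun ω hω => ?_).trans (hc.trans (ENNReal.ofReal_le_ofReal ?_))
  · simp only [Set.mem_ofPred_eq] at hω ⊢
    have : (∑ i ∈ W, X i) ω ≤ κ * W.card := by simpa [X] using hω
    rw [abs_sub_comm]
    refine le_trans ?_ (le_abs_self _)
    linarith
  · rw [div_div, div_le_div_iff₀ (by positivity) (by positivity)]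
    calc _ ≤ η ^ 2 * W.card * (κ ^ 2 * W.card) := by gcongr
      _ = _ := by ring

/-- On a block of observations with nondegenerate Gram matrix, the loss increases by an amount
proportional to the length of the block, uniformly over all parameter vectors at a fixed distance
from the true one, except with a probability inversely proportional to that length. -/
theorem ErrorAssumptions.exists_measure_sphere_le [IsProbabilityMeasure ν] (hτ : 0 < τ ∧ τ < 1)
    (hν : ErrorAssumptions τ ν) (hmeas : ∀ i, Measurable (ε i))
    (hindep : iIndepFun ε P) (hlaw : ∀ i, P.map (ε i) = ν) (p : ℕ) {m η : ℝ} (hm : 0 < m)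
    (hη : 0 < η) :
    ∃ κ C : ℝ, 0 < κ ∧ 0 ≤ C ∧ ∀ (W : Finset ℕ) (x : ℕ → EuclideanSpace ℝ (Fin p)), W.Nonempty →
      (∀ i ∈ W, ‖x i‖ ≤ 1) → (∀ v, m * ‖v‖ ^ 2 * W.card ≤ ∑ i ∈ W, (inner ℝ (x i) v) ^ 2) →
      P {ω | ∃ v, ‖v‖ = η ∧ ∑ i ∈ W, checkShift τ (inner ℝ (x i) v) (ε i ω) ≤ κ * W.card} ≤
        ENNReal.ofReal (C / W.card) := by
  -- The additive error `4 c²` may use up at most half of the Gram bound `m η²`.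
  obtain ⟨c, hc, hcm⟩ : ∃ c : ℝ, 0 < c ∧ 4 * c ^ 2 ≤ m * η ^ 2 / 2 := by
    refine ⟨Real.sqrt (m * η ^ 2 / 8), by positivity, ?_⟩
    rw [Real.sq_sqrt (by positivity)]; linarith
  obtain ⟨q, hq, hquad⟩ := hν.exists_quadratic_le hτ hc hη
  -- The mean is then at least `q m / 2 = 4κ` per observation: Chebyshev loses `2κ`, and passing to
  -- the net loses another `κ`.
  set κ := q * m / 8 with hκ_def
  have hκ : 0 < κ := by positivity
  obtain ⟨T, hTs, hTf, hT⟩ := (isCompact_sphere (0 : EuclideanSpace ℝ (Fin p)) η).finite_cover_balls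
    hκ
  refine ⟨κ, hTf.toFinset.card * (η ^ 2 / (2 * κ) ^ 2), hκ, by positivity,
    fun W x hW hx hgram => ?_⟩
  have hinner : ∀ i ∈ W, ∀ v, |inner ℝ (x i) v| ≤ ‖v‖ := fun i hi v =>
    (abs_real_inner_le_norm _ _).trans (mul_le_of_le_one_left (norm_nonneg _) (hx i hi))
  have hsub : {ω | ∃ v, ‖v‖ = η ∧
      ∑ i ∈ W, checkShift τ (inner ℝ (x i) v) (ε i ω) ≤ κ * W.card} ⊆
      ⋃ v ∈ hTf.toFinset,
        {ω | ∑ i ∈ W, checkShift τ (inner ℝ (x i) v) (ε i ω) ≤ 2 * κ * W.card} := by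
    rintro ω ⟨v, hv, hle⟩
    have hv' := hT (show v ∈ Metric.sphere 0 η by simpa using hv)
    simp only [Set.mem_iUnion, Metric.mem_ball, dist_eq_norm] at hv'
    obtain ⟨v₀, hv₀, hd⟩ := hv'
    simp only [Set.mem_iUnion, Set.mem_ofPred_eq]
    refine ⟨v₀, by simpa using hv₀, ?_⟩
    have : ∑ i ∈ W, (checkShift τ (inner ℝ (x i) v₀) (ε i ω)
        - checkShift τ (inner ℝ (x i) v) (ε i ω)) ≤ κ * W.card := by
      rw [mul_comm, ← nsmul_eq_mul]
      refine Finset.sum_le_card_nsmul _ _ _ fun i hi => ?_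
      refine (le_abs_self _).trans ((abs_checkShift_sub_le hτ _ _ _).trans ?_)
      rw [← inner_sub_right]
      refine (hinner i hi _).trans ?_
      rw [norm_sub_rev]
      exact hd.le
    rw [Finset.sum_sub_distrib] at this
    linarith
  refine (measure_mono hsub).trans ((measure_biUnion_finset_le _ _).trans ?_)
  have hnet : ∀ v ∈ hTf.toFinset,
      P {ω | ∑ i ∈ W, checkShift τ (inner ℝ (x i) v) (ε i ω) ≤ 2 * κ * W.card} ≤
        ENNReal.ofReal (η ^ 2 / (2 * κ) ^ 2 / W.card) := fun v hv => by
    have hvη : ‖v‖ = η := by simpa using hTs (hTf.mem_toFinset.1 hv)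
    refine measure_sum_checkShift_le hτ hmeas hindep hlaw W hW _ (by positivity)
      (fun i hi => (hinner i hi v).trans hvη.le) ?_
    calc 2 * (2 * κ) * W.card = q * ((m * η ^ 2 * W.card - m * η ^ 2 / 2 * W.card) / η ^ 2) := by
          rw [hκ_def]; field_simp; ring
      _ ≤ q * ((∑ i ∈ W, (inner ℝ (x i) v) ^ 2 - 4 * c ^ 2 * W.card) / η ^ 2) := by
          have := hgram v
          rw [hvη] at this
          gcongr
      _ = ∑ i ∈ W, q * (((inner ℝ (x i) v) ^ 2 - 4 * c ^ 2) / η ^ 2) := by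
          rw [← Finset.mul_sum, ← Finset.sum_div, Finset.sum_sub_distrib, Finset.sum_const,
            nsmul_eq_mul, mul_comm (W.card : ℝ)]
      _ ≤ _ := Finset.sum_le_sum fun i hi => hquad _ ((hinner i hi v).trans hvη.le)
  refine (Finset.sum_le_card_nsmul _ _ _ hnet).trans (le_of_eq ?_)
  rw [nsmul_eq_mul, mul_div_assoc, ENNReal.ofReal_mul (by positivity), ENNReal.ofReal_natCast]

end Concentration

/-! ### Gram matrices as quadratic forms. -/

theorem gram_isHermitian {p : ℕ} (x : ℕ → EuclideanSpace ℝ (Fin p)) (n₁ n₂ : ℕ) :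
    (gram x n₁ n₂).IsHermitian := by
  ext i j
  simp [gram, Matrix.sum_apply, Matrix.vecMulVec_apply, mul_comm]

/-- Subtracting `m • 1` shifts the spectrum by `m`, so the difference is positive semidefinite. -/
theorem mul_norm_sq_le_sum_inner_sq {p : ℕ} {x : ℕ → EuclideanSpace ℝ (Fin p)} {n₁ n₂ : ℕ}
    (hlt : n₁ < n₂) {m : ℝ} (h : ∀ μ ∈ spectrum ℝ (gram x n₁ n₂), m ≤ μ)
    (v : EuclideanSpace ℝ (Fin p)) :
    m * ‖v‖ ^ 2 * ((n₂ : ℝ) - n₁) ≤ ∑ i ∈ Finset.Ico n₁ n₂, (inner ℝ (x i) v) ^ 2 := by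
  have hpos : (0 : ℝ) < (n₂ : ℝ) - n₁ := by rw [sub_pos]; exact_mod_cast hlt
  have hm1 : (m • (1 : Matrix (Fin p) (Fin p) ℝ)).IsHermitian := by
    ext i j; simp [Matrix.one_apply, eq_comm]
  have hps : (gram x n₁ n₂ - m • (1 : Matrix (Fin p) (Fin p) ℝ)).PosSemidef := by
    rw [Matrix.posSemidef_iff_isHermitian_and_spectrum_nonneg]
    refine ⟨(gram_isHermitian x n₁ n₂).sub hm1, fun μ hμ => ?_⟩
    rw [← Algebra.algebraMap_eq_smul_one, ← spectrum.sub_singleton_eq] at hμ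
    obtain ⟨y, hy, z, hz, rfl⟩ := hμ
    rw [Set.mem_singleton_iff] at hz
    subst hz
    exact sub_nonneg.2 (h y hy)
  have hq := hps.dotProduct_mulVec_nonneg (v : Fin p → ℝ)
  have hv : ‖v‖ ^ 2 = (v : Fin p → ℝ) ⬝ᵥ v := by
    rw [EuclideanSpace.real_norm_sq_eq]; simp [dotProduct, sq]
  have hi : ∀ i, inner ℝ (x i) v = (v : Fin p → ℝ) ⬝ᵥ x i := fun i => by
    simp [PiLp.inner_apply, dotProduct]
  have hg : (v : Fin p → ℝ) ⬝ᵥ ((gram x n₁ n₂).mulVec v) =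
      ((n₂ : ℝ) - n₁)⁻¹ * ∑ i ∈ Finset.Ico n₁ n₂, (inner ℝ (x i) v) ^ 2 := by
    simp only [gram, Matrix.smul_mulVec, Matrix.sum_mulVec, dotProduct_smul, dotProduct_sum,
      smul_eq_mul, Matrix.vecMulVec_mulVec, hi]
    congr 1
    refine Finset.sum_congr rfl fun i _ => ?_
    rw [dotProduct_comm (x i).ofLp, sq]
    simp
  rw [star_trivial, Matrix.sub_mulVec, dotProduct_sub, hg, Matrix.smul_mulVec, Matrix.one_mulVec,
    dotProduct_smul, ← hv, smul_eq_mul, sub_nonneg] at hq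
  have := mul_le_mul_of_nonneg_right hq hpos.le
  calc _ ≤ _ := this
    _ = _ := by field_simp

/-! ### Order and spacing of change-points. -/

section ChangePoints

variable {p n : ℕ} {β : ℕ → EuclideanSpace ℝ (Fin p)}

theorem mem_changePoints {i : ℕ} :
    i ∈ changePoints n β ↔ (2 ≤ i ∧ i ≤ n) ∧ β i ≠ β (i - 1) := by
  simp [changePoints]

theorem cpt_zero : cpt n β 0 = 1 := rfl

theorem cpt_succ {K : ℕ} (h : (changePoints n β).card = K) (j : Fin K) :
    cpt n β (j + 1) = (changePoints n β).orderEmbOfFin h j := by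
  rw [Finset.orderEmbOfFin_apply, cpt, List.getD_cons_succ, List.getD_eq_getElem]
  rfl

theorem cpt_card_succ : cpt n β ((changePoints n β).card + 1) = n := by
  rw [cpt, List.getD_cons_succ, List.getD_eq_default]
  simp

theorem exists_cpt_eq {i : ℕ} (hi : i ∈ changePoints n β) :
    ∃ j < (changePoints n β).card, cpt n β (j + 1) = i := by
  have : i ∈ Set.range ((changePoints n β).orderEmbOfFin rfl) := by
    rw [Finset.range_orderEmbOfFin]; exact hi
  obtain ⟨j, rfl⟩ := this
  exact ⟨j, j.2, cpt_succ rfl j⟩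

theorem le_cpt_succ_sub_cpt {d : ℝ} (h : d ≤ minGap n β) {k : ℕ}
    (hk : k ≤ (changePoints n β).card) : d ≤ (cpt n β (k + 1) : ℝ) - cpt n β k :=
  h.trans (Finset.inf'_le _ (Finset.mem_range.2 (Nat.lt_succ_of_le hk)))

theorem cpt_lt_cpt (h : 0 < minGap n β) {j k : ℕ} (hjk : j < k)
    (hk : k ≤ (changePoints n β).card + 1) : cpt n β j < cpt n β k := by
  induction k, hjk using Nat.le_induction with
  | base =>
    have := (lt_of_lt_of_le h (le_cpt_succ_sub_cpt le_rfl (by lia : j ≤ _)))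
    exact_mod_cast sub_pos.1 this
  | succ k hjk ih =>
    have := (lt_of_lt_of_le h (le_cpt_succ_sub_cpt le_rfl (by lia : k ≤ _)))
    exact (ih (by lia)).trans (by exact_mod_cast sub_pos.1 this)

theorem notMem_changePoints_of_cpt_lt_of_lt_cpt (h : 0 < minGap n β) {k i : ℕ}
    (hk : k ≤ (changePoints n β).card) (h1 : cpt n β k < i) (h2 : i < cpt n β (k + 1)) :
    i ∉ changePoints n β := by
  intro hi
  obtain ⟨j, hj, rfl⟩ := exists_cpt_eq hi
  rcases lt_trichotomy (j + 1) k with hlt | rfl | hlt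
  · exact (cpt_lt_cpt h hlt (by lia)).not_gt h1
  · exact h1.false
  · rcases eq_or_lt_of_le (Nat.succ_le_of_lt hlt) with heq | hlt'
    · rw [← heq] at h2; exact h2.false
    · exact (cpt_lt_cpt h hlt' (by lia)).not_gt h2

theorem eq_of_forall_notMem_changePoints {a b : ℕ} (ha : 1 ≤ a) (hb : b ≤ n + 1)
    (h : ∀ i, a < i → i < b → i ∉ changePoints n β) {i : ℕ} (hai : a ≤ i) (hib : i < b) :
    β i = β a := by
  induction i, hai using Nat.le_induction with
  | base => rfl
  | succ i hai ih =>
    have := h (i + 1) (by lia) hib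
    rw [mem_changePoints, not_and_not_right] at this
    rw [this ⟨by lia, by lia⟩]
    exact ih (by lia)

/-- If every change-point of `β` has a change-point of `b` within half of the minimal gap, and
`b` has as many change-points as `β`, then the change-points are close in order. -/
theorem abs_cpt_sub_cpt_lt {b : ℕ → EuclideanSpace ℝ (Fin p)} {K : ℕ} {d : ℝ}
    (hβ : (changePoints n β).card = K) (hb : (changePoints n b).card = K)
    (hd : d ≤ minGap n β)
    (h : ∀ k ∈ Finset.Icc 1 K, ∃ t ∈ changePoints n b, |(t : ℝ) - cpt n β k| < d / 2)
    {k : ℕ} (hk : k ∈ Finset.Icc 1 K) : |(cpt n b k : ℝ) - cpt n β k| < d / 2 := by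
  have h' : ∀ j : Fin K, ∃ t ∈ changePoints n b, |(t : ℝ) - cpt n β (j + 1)| < d / 2 :=
    fun j => h _ (Finset.mem_Icc.2 ⟨by lia, j.2⟩)
  choose f hf hfd using h'
  obtain _ | K := K
  · simp at hk
  -- Consecutive targets are at least `d` apart and each error is below `d / 2`. A strictly
  -- increasing choice of `K` elements from a set of size `K` is its ordered enumeration.
  have hmono : StrictMono f := Fin.strictMono_iff_lt_succ.2 fun j => by
    have h1 := abs_lt.1 (hfd j.castSucc)
    have h2 := abs_lt.1 (hfd j.succ)
    have h3 := le_cpt_succ_sub_cpt hd (k := j + 1) (by lia)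
    simp only [Fin.val_castSucc, Fin.val_succ] at h1 h2
    have : (f j.castSucc : ℝ) < f j.succ := by linarith
    exact_mod_cast this
  have heq := Finset.orderEmbOfFin_unique hb hf hmono
  rw [Finset.mem_Icc] at hk
  have hk' := hfd ⟨k - 1, by lia⟩
  rw [heq, ← cpt_succ hb] at hk'
  simpa [Nat.sub_add_cancel hk.1] using hk'

end ChangePoints

/-! ### Consequences of minimality on a block. -/

section Estimate

variable {p n : ℕ} {x : ℕ → EuclideanSpace ℝ (Fin p)} {τ lam : ℝ} {Y : ℕ → ℝ}
  {β : ℕ → EuclideanSpace ℝ (Fin p)}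

/-- Changing the value of an estimate on a block where it is constant cannot decrease the loss on
the block by more than the change of the penalty at the two ends of the block. -/
theorem IsEstimate.sum_check_le (h : IsEstimate τ lam n x Y β) (hlam : 0 ≤ lam) {a c : ℕ}
    (ha : 1 ≤ a) (hc : c ≤ n + 1) (hconst : ∀ i ∈ Finset.Ico a c, β i = β a)
    (φ : EuclideanSpace ℝ (Fin p)) :
    ∑ i ∈ Finset.Ico a c, check τ (Y i - inner ℝ (x i) (β a)) ≤
      ∑ i ∈ Finset.Ico a c, check τ (Y i - inner ℝ (x i) φ) + 2 * (n * lam) * ‖β a - φ‖ := by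
  classical
  let b : ℕ → EuclideanSpace ℝ (Fin p) := fun i => if i ∈ Finset.Ico a c then φ else β i
  have hb := h b
  have hsub : Finset.Ico a c ⊆ Finset.Icc 1 n := fun i hi => by
    simp only [Finset.mem_Ico, Finset.mem_Icc] at hi ⊢; lia
  have hpen : ∑ i ∈ Finset.Icc 2 n, ‖b i - b (i - 1)‖ ≤
      ∑ i ∈ Finset.Icc 2 n, ‖β i - β (i - 1)‖ + 2 * ‖β a - φ‖ := by
    -- Only the differences entering the block (`i = a`) and leaving it (`i = c`) can grow; for `c =
    -- n + 1` the latter does not occur.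
    have hi : ∀ i ∈ Finset.Icc 2 n, ‖b i - b (i - 1)‖ ≤ ‖β i - β (i - 1)‖ +
        ((if i = a then ‖β a - φ‖ else 0) + if i = c then ‖β a - φ‖ else 0) := fun i hi => by
      rw [Finset.mem_Icc] at hi
      by_cases h1 : i ∈ Finset.Ico a c <;> by_cases h2 : i - 1 ∈ Finset.Ico a c
      · simp only [b, h1, h2, if_true, sub_self, norm_zero]
        positivity
      · have hia : i = a := by simp only [Finset.mem_Ico] at h1 h2; lia
        simp only [b, h1, h2, if_true, if_false]
        subst hia
        have : ‖φ - β (i - 1)‖ ≤ ‖φ - β i‖ + ‖β i - β (i - 1)‖ := 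
          norm_sub_le_norm_sub_add_norm_sub ..
        rw [norm_sub_rev φ (β i)] at this
        have h0 : 0 ≤ if i = c then ‖β i - φ‖ else 0 := by positivity
        rw [if_pos rfl]
        linarith
      · have hic : i = c := by simp only [Finset.mem_Ico] at h1 h2; lia
        simp only [b, h1, h2, if_true, if_false, if_pos hic]
        rw [hconst _ h2]
        have : ‖β i - φ‖ ≤ ‖β i - β a‖ + ‖β a - φ‖ := norm_sub_le_norm_sub_add_norm_sub ..
        have h0 : 0 ≤ if i = a then ‖β a - φ‖ else 0 := by positivity
        linarith
      · simp only [b, h1, h2, if_false]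
        have : 0 ≤ ((if i = a then ‖β a - φ‖ else 0) + if i = c then ‖β a - φ‖ else 0) := by
          positivity
        linarith
    refine (Finset.sum_le_sum hi).trans ?_
    rw [Finset.sum_add_distrib, Finset.sum_add_distrib, Finset.sum_ite_eq', Finset.sum_ite_eq',
      two_mul]
    have := norm_nonneg (β a - φ)
    split_ifs <;> linarith
  have hloss : ∑ i ∈ Finset.Icc 1 n, check τ (Y i - inner ℝ (x i) (b i))
      - ∑ i ∈ Finset.Icc 1 n, check τ (Y i - inner ℝ (x i) (β i)) =
      ∑ i ∈ Finset.Ico a c, check τ (Y i - inner ℝ (x i) φ)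
      - ∑ i ∈ Finset.Ico a c, check τ (Y i - inner ℝ (x i) (β a)) := by
    rw [← Finset.sum_sub_distrib, ← Finset.sum_sub_distrib]
    symm
    rw [← Finset.sum_subset hsub (fun i _ hi => by simp only [b, if_neg hi, sub_self])]
    refine Finset.sum_congr rfl fun i hi => ?_
    simp only [b, hi, if_true, hconst i hi]
  unfold objective at hb
  have := mul_le_mul_of_nonneg_left hpen (mul_nonneg n.cast_nonneg hlam : (0 : ℝ) ≤ n * lam)
  linarith

/-- If, on a block of observations from a single regime with parameter `φ`, an estimate is constant
and the loss increases sufficiently on a sphere around `φ`, then the value of the estimate is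
inside the sphere. -/
theorem IsEstimate.norm_sub_lt (h : IsEstimate τ lam n x Y β) (hlam : 0 ≤ lam) {a c : ℕ}
    (ha : 1 ≤ a) (hc : c ≤ n + 1) (hconst : ∀ i ∈ Finset.Ico a c, β i = β a)
    {φ : EuclideanSpace ℝ (Fin p)} {e : ℕ → ℝ}
    (hY : ∀ i ∈ Finset.Ico a c, Y i = inner ℝ (x i) φ + e i) {η : ℝ} (hη : 0 < η)
    (hgood : ∀ v, ‖v‖ = η →
      2 * (n * lam) * η < ∑ i ∈ Finset.Ico a c, checkShift τ (inner ℝ (x i) v) (e i)) :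
    ‖β a - φ‖ < η := by
  by_contra! hle
  have hpos : 0 < ‖β a - φ‖ := hη.trans_le hle
  -- Contract the deviation onto the sphere: convexity scales the loss difference by `s`, turning
  -- the penalty bound into exactly `2 n λ η`.
  set s := η / ‖β a - φ‖ with hs
  have hs0 : 0 ≤ s := by positivity
  have hs1 : s ≤ 1 := (div_le_one hpos).2 hle
  have hsη : s * ‖β a - φ‖ = η := by rw [hs]; field_simp
  have hv := hgood (s • (β a - φ)) (by rw [norm_smul, Real.norm_of_nonneg hs0, hsη])
  have h1 := h.sum_check_le hlam ha hc hconst φ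
  have h2 : ∑ i ∈ Finset.Ico a c, checkShift τ (inner ℝ (x i) (s • (β a - φ))) (e i) ≤
      s * (∑ i ∈ Finset.Ico a c, check τ (Y i - inner ℝ (x i) (β a)) -
        ∑ i ∈ Finset.Ico a c, check τ (Y i - inner ℝ (x i) φ)) := by
    rw [← Finset.sum_sub_distrib, Finset.mul_sum]
    refine Finset.sum_le_sum fun i hi => ?_
    have := check_sub_mul_le τ (e i) (inner ℝ (x i) (β a - φ)) hs0 hs1
    rw [inner_smul_right, checkShift, hY i hi]
    refine this.trans (le_of_eq ?_)
    rw [inner_sub_right]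
    congr 3 <;> ring
  have h3 := mul_le_mul_of_nonneg_left (sub_le_iff_le_add'.2 h1) hs0
  rw [mul_left_comm, hsη] at h3
  linarith

end Estimate

/-! ### Localization of one change-point. -/

section Deterministic

variable {p n : ℕ} {β : ℕ → EuclideanSpace ℝ (Fin p)}

theorem cpt_add_le_cpt_succ {w : ℕ} (hw : (w : ℝ) ≤ minGap n β) {k : ℕ}
    (hk : k ≤ (changePoints n β).card) : cpt n β k + w ≤ cpt n β (k + 1) := by
  have := le_cpt_succ_sub_cpt hw hk
  have : ((cpt n β k + w : ℕ) : ℝ) ≤ cpt n β (k + 1) := by push_cast; linarith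
  exact_mod_cast this

/-- Keeps the left block inside the sample, so that the natural subtraction `cpt n β k - w` is not
truncated. -/
theorem one_add_le_cpt {w : ℕ} (hw0 : 0 < w) (hw : (w : ℝ) ≤ minGap n β) {k : ℕ}
    (hk : k ∈ Finset.Icc 1 (changePoints n β).card) : 1 + w ≤ cpt n β k := by
  rw [Finset.mem_Icc] at hk
  have hpos : 0 < minGap n β := lt_of_lt_of_le (by exact_mod_cast hw0) hw
  have h1 := cpt_add_le_cpt_succ hw (k := k - 1) (by lia)
  rw [Nat.sub_add_cancel hk.1] at h1
  rcases Nat.eq_zero_or_pos (k - 1) with h0 | h0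
  · rwa [h0, cpt_zero] at h1
  · have := cpt_lt_cpt hpos h0 (by lia)
    rw [cpt_zero] at this
    lia

theorem cpt_add_le {w : ℕ} (hw0 : 0 < w) (hw : (w : ℝ) ≤ minGap n β) {k : ℕ}
    (hk : k ∈ Finset.Icc 1 (changePoints n β).card) : cpt n β k + w ≤ n := by
  rw [Finset.mem_Icc] at hk
  have hpos : 0 < minGap n β := lt_of_lt_of_le (by exact_mod_cast hw0) hw
  refine (cpt_add_le_cpt_succ hw hk.2).trans ?_
  rcases eq_or_lt_of_le hk.2 with rfl | h
  · exact cpt_card_succ.le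
  · exact (cpt_lt_cpt hpos (Nat.succ_lt_succ h) le_rfl).le.trans cpt_card_succ.le

theorem eq_of_mem_Ico_cpt_sub {w : ℕ} (hw0 : 0 < w) (hw : (w : ℝ) ≤ minGap n β) {k : ℕ}
    (hk : k ∈ Finset.Icc 1 (changePoints n β).card) {i : ℕ}
    (hi : i ∈ Finset.Ico (cpt n β k - w) (cpt n β k)) : β i = β (cpt n β k - 1) := by
  have hpos : 0 < minGap n β := lt_of_lt_of_le (by exact_mod_cast hw0) hw
  have h1 := one_add_le_cpt hw0 hw hk
  have h2 := cpt_add_le hw0 hw hk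
  rw [Finset.mem_Icc] at hk
  rw [Finset.mem_Ico] at hi
  have h3 := cpt_add_le_cpt_succ hw (k := k - 1) (by lia)
  rw [Nat.sub_add_cancel hk.1] at h3
  symm
  refine eq_of_forall_notMem_changePoints (a := i) (b := cpt n β k) (n := n) (by lia) (by lia)
    (fun j hj hj' => ?_) (by lia) (by lia)
  refine notMem_changePoints_of_cpt_lt_of_lt_cpt hpos (k := k - 1) (by lia) (by lia) ?_
  rwa [Nat.sub_add_cancel hk.1]

theorem eq_of_mem_Ico_cpt_add {w : ℕ} (hw0 : 0 < w) (hw : (w : ℝ) ≤ minGap n β) {k : ℕ}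
    (hk : k ∈ Finset.Icc 1 (changePoints n β).card) {i : ℕ}
    (hi : i ∈ Finset.Ico (cpt n β k) (cpt n β k + w)) : β i = β (cpt n β k) := by
  have hpos : 0 < minGap n β := lt_of_lt_of_le (by exact_mod_cast hw0) hw
  have h1 := one_add_le_cpt hw0 hw hk
  have h2 := cpt_add_le hw0 hw hk
  rw [Finset.mem_Icc] at hk
  rw [Finset.mem_Ico] at hi
  have h3 := cpt_add_le_cpt_succ hw hk.2
  exact eq_of_forall_notMem_changePoints (b := cpt n β k + w) (n := n) (by lia) (by lia)
    (fun j hj hj' => notMem_changePoints_of_cpt_lt_of_lt_cpt hpos hk.2 hj (by lia)) hi.1 hi.2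

/-- If the loss increases sufficiently on spheres around the true parameters, over the blocks of
length `w` before and after a change-point, then an estimate has a change-point less than `w` away
from it. -/
theorem IsEstimate.exists_mem_changePoints {x b : ℕ → EuclideanSpace ℝ (Fin p)} {τ lam : ℝ}
    {Y e : ℕ → ℝ} (h : IsEstimate τ lam n x Y b) (hlam : 0 ≤ lam)
    (hY : ∀ i ∈ Finset.Icc 1 n, Y i = inner ℝ (x i) (β i) + e i) {w : ℕ} (hw0 : 0 < w)
    (hw : (w : ℝ) ≤ minGap n β) {k : ℕ} (hk : k ∈ Finset.Icc 1 (changePoints n β).card) {η : ℝ}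
    (hη : 0 < η) (hjump : 2 * η ≤ ‖jump n β k‖)
    (hleft : ∀ v, ‖v‖ = η → 2 * (n * lam) * η <
      ∑ i ∈ Finset.Ico (cpt n β k - w) (cpt n β k), checkShift τ (inner ℝ (x i) v) (e i))
    (hright : ∀ v, ‖v‖ = η → 2 * (n * lam) * η <
      ∑ i ∈ Finset.Ico (cpt n β k) (cpt n β k + w), checkShift τ (inner ℝ (x i) v) (e i)) :
    ∃ t ∈ changePoints n b, cpt n β k < t + w ∧ t < cpt n β k + w := by
  by_contra! hno
  have h1 := one_add_le_cpt hw0 hw hk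
  have h2 := cpt_add_le hw0 hw hk
  have hconst : ∀ i, cpt n β k - w ≤ i → i < cpt n β k + w → b i = b (cpt n β k - w) :=
    fun i hi hi' => eq_of_forall_notMem_changePoints (b := cpt n β k + w) (n := n) (by lia) (by lia)
      (fun j hj hj' hmem => absurd (hno j hmem (by lia)) (by lia)) hi hi'
  have hl : ‖b (cpt n β k - w) - β (cpt n β k - 1)‖ < η := by
    refine h.norm_sub_lt hlam (c := cpt n β k) (by lia) (by lia) (fun i hi => ?_) (fun i hi => ?_)
      hη hleft
    · rw [Finset.mem_Ico] at hi
      exact hconst i hi.1 (by lia)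
    · rw [← eq_of_mem_Ico_cpt_sub hw0 hw hk hi]
      rw [Finset.mem_Ico] at hi
      exact hY i (Finset.mem_Icc.2 (by lia))
  have hr : ‖b (cpt n β k) - β (cpt n β k)‖ < η := by
    refine h.norm_sub_lt hlam (c := cpt n β k + w) (by lia) (by lia) (fun i hi => ?_)
      (fun i hi => ?_) hη hright
    · rw [Finset.mem_Ico] at hi
      rw [hconst i (by lia) hi.2, hconst (cpt n β k) (by lia) (by lia)]
    · rw [← eq_of_mem_Ico_cpt_add hw0 hw hk hi]
      rw [Finset.mem_Ico] at hi
      exact hY i (Finset.mem_Icc.2 (by lia))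
  rw [hconst (cpt n β k) (by lia) (by lia), norm_sub_rev] at hr
  have := norm_sub_le_norm_sub_add_norm_sub (β (cpt n β k)) (b (cpt n β k - w))
    (β (cpt n β k - 1))
  rw [← jump] at this
  linarith

end Deterministic

/-! ### Passage to the limit. -/

theorem RateAssumptions.tendsto_mul_delta {N : ℕ} {δ lam : ℕ → ℝ} (h : RateAssumptions N δ lam) :
    Tendsto (fun n : ℕ => n * δ n) atTop atTop := by
  have hlog : Tendsto (fun n : ℕ => Real.log n) atTop atTop :=
    Real.tendsto_log_atTop.comp tendsto_natCast_atTop_atTop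
  refine tendsto_atTop_mono' _ ?_ h.delta_log
  filter_upwards [hlog.eventually_ge_atTop 1, h.delta_log.eventually_ge_atTop 0] with n h1 h2
  have h3 : (n : ℝ) * δ n = Real.log n * ((Real.log n)⁻¹ * (n * δ n)) := by field_simp
  refine le_trans ?_ h3.ge
  exact le_mul_of_one_le_left h2 h1

theorem tendsto_measure_one_of_tendsto_measure_diff {Ω : Type*} [MeasurableSpace Ω] {P : Measure Ω}
    [IsProbabilityMeasure P] {A B : ℕ → Set Ω} (hAB : Tendsto (fun n => P (A n \ B n)) atTop (𝓝 0))
    (hA : Tendsto (fun n => P (A n)) atTop (𝓝 1)) : Tendsto (fun n => P (B n)) atTop (𝓝 1) := by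
  have h := ENNReal.Tendsto.sub hA hAB (Or.inl ENNReal.one_ne_top)
  rw [tsub_zero] at h
  refine tendsto_of_tendsto_of_tendsto_of_le_of_le h tendsto_const_nhds (fun n => ?_)
    fun n => prob_le_one
  rw [tsub_le_iff_right]
  refine (measure_mono fun ω hω => ?_).trans (measure_union_le (B n) (A n \ B n))
  by_cases hB : ω ∈ B n
  · exact Or.inl hB
  · exact Or.inr ⟨hω, hB⟩

/-- With probability tending to one, an estimate with the right number of change-points locates
each of them up to an error smaller than `n δ_n / 2`. -/
theorem tendsto_measure_card_eq_and_not_close {Ω : Type*} [MeasurableSpace Ω] {P : Measure Ω}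
    [IsProbabilityMeasure P] {p : ℕ} [NeZero p] {N K : ℕ} {τ : ℝ} (hτ : 0 < τ ∧ τ < 1)
    {x β : ℕ → ℕ → EuclideanSpace ℝ (Fin p)} {δ lam : ℕ → ℝ} {ε : ℕ → Ω → ℝ} {ν : Measure ℝ}
    [IsProbabilityMeasure ν] (hmeas : ∀ i, Measurable (ε i)) (hindep : iIndepFun ε P)
    (hlaw : ∀ i, P.map (ε i) = ν) {Y : ℕ → ℕ → Ω → ℝ}
    (hY : ∀ n ≥ N, ∀ i ∈ Finset.Icc 1 n, ∀ ω, Y n i ω = inner ℝ (x n i) (β n i) + ε i ω)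
    (hdesign : DesignAssumptions N x δ) (herror : ErrorAssumptions τ ν)
    (hrate : RateAssumptions N δ lam) (hchange : ChangeAssumptions N K τ ν x δ β)
    {βhat : ℕ → Ω → ℕ → EuclideanSpace ℝ (Fin p)}
    (hest : ∀ n ≥ N, ∀ᵐ ω ∂P, IsEstimate τ (lam n) n (x n) (fun i => Y n i ω) (βhat n ω)) :
    Tendsto (fun n : ℕ => P {ω | (changePoints n (βhat n ω)).card = K ∧
      ¬ ∀ k ∈ Finset.Icc 1 K, |(cpt n (βhat n ω) k : ℝ) - cpt n (β n) k| < n * δ n / 2})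
      atTop (𝓝 0) := by
  obtain ⟨cx, -, hcx, hx⟩ := hdesign.bounded
  obtain ⟨m, M, hm, -, hgram⟩ := hdesign.eigenvalues
  obtain ⟨cb, hcb, hjump⟩ := hchange.jump_large
  have hη : 0 < cb / 2 := by positivity
  obtain ⟨κ, C, hκ, hC, hprob⟩ :=
    herror.exists_measure_sphere_le hτ hmeas hindep hlaw p hm hη
  have hbound : ∀ᶠ n : ℕ in atTop, P {ω | (changePoints n (βhat n ω)).card = K ∧
      ¬ ∀ k ∈ Finset.Icc 1 K, |(cpt n (βhat n ω) k : ℝ) - cpt n (β n) k| < n * δ n / 2} ≤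
      ENNReal.ofReal (K * (2 * (C / (n * δ n / 2)))) := by
    filter_upwards [eventually_ge_atTop N, hrate.tendsto_mul_delta.eventually_ge_atTop 2,
      hrate.lam_delta.eventually_lt_const (show 0 < κ / (2 * cb) by positivity)] with n hn hnδ hlamδ
    have hδ := hrate.delta_pos n hn
    have hlam := hrate.lam_pos n hn
    have hcard := hchange.card n hn
    -- Long enough for the eigenvalue bound, and below `n δ_n / 2 + 1 ≤ n δ_n`, hence within the
    -- minimal gap.
    set w := ⌈n * δ n / 2⌉₊ with hw_def
    have hw_ge : n * δ n / 2 ≤ w := Nat.le_ceil _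
    have hw_lt : (w : ℝ) < n * δ n / 2 + 1 := Nat.ceil_lt_add_one (by linarith)
    have hw0 : 0 < w := Nat.ceil_pos.2 (by linarith)
    have hw : (w : ℝ) ≤ minGap n (β n) := le_trans (by linarith) (hchange.gap n hn)
    have hpen : 2 * (n * lam n) * (cb / 2) ≤ κ * w := by
      rw [div_lt_div_iff₀ hδ (by positivity)] at hlamδ
      have : κ * (n * δ n / 2) ≤ κ * w := by gcongr
      have : n * (lam n * (2 * cb)) ≤ n * (κ * δ n) := by gcongr
      linarith
    let bad : ℕ → Set Ω := fun a => {ω | ∃ v, ‖v‖ = cb / 2 ∧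
      ∑ i ∈ Finset.Ico a (a + w), checkShift τ (inner ℝ (x n i) v) (ε i ω) ≤ κ * w}
    have hbad : ∀ a, 1 ≤ a → a + w ≤ n → P (bad a) ≤ ENNReal.ofReal (C / (n * δ n / 2)) := by
      intro a ha han
      have hlen : (Finset.Ico a (a + w)).card = w := by simp
      have hdiff : ((a + w : ℕ) : ℝ) - a = w := by push_cast; ring
      have := hprob (Finset.Ico a (a + w)) (x n) (by simpa using hw0)
        (fun i hi => by
          rw [Finset.mem_Ico] at hi
          exact (hx n hn i (Finset.mem_Icc.2 (by lia))).trans hcx.le)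
        (fun v => by
          have := mul_norm_sq_le_sum_inner_sq (x := x n) (by lia : a < a + w)
            (fun μ hμ => (hgram n hn a (a + w) ha (by lia) han (by rw [hdiff]; exact hw_ge) μ hμ).1)
            v
          rwa [hlen, ← hdiff])
      rw [hlen] at this
      refine this.trans (ENNReal.ofReal_le_ofReal ?_)
      exact div_le_div_of_nonneg_left hC (by linarith) hw_ge
    have hsub : {ω | (changePoints n (βhat n ω)).card = K ∧
        ¬ ∀ k ∈ Finset.Icc 1 K, |(cpt n (βhat n ω) k : ℝ) - cpt n (β n) k| < n * δ n / 2} ⊆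
        {ω | ¬ IsEstimate τ (lam n) n (x n) (fun i => Y n i ω) (βhat n ω)} ∪
        ⋃ k ∈ Finset.Icc 1 K, (bad (cpt n (β n) k - w) ∪ bad (cpt n (β n) k)) := by
      rintro ω ⟨hK, hnot⟩
      by_contra hω
      simp only [Set.mem_union, Set.mem_iUnion, not_or, not_exists, Set.mem_ofPred_eq, not_not]
        at hω
      obtain ⟨hE, hgood⟩ := hω
      refine hnot fun k hk => abs_cpt_sub_cpt_lt hcard hK (hchange.gap n hn) (fun k hk => ?_) hk
      have hk' : k ∈ Finset.Icc 1 (changePoints n (β n)).card := by rwa [hcard]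
      have h1 := one_add_le_cpt hw0 hw hk'
      obtain ⟨g1, g2⟩ := hgood k hk
      simp only [bad, Set.mem_ofPred_eq, not_exists, not_and, not_le] at g1 g2
      rw [Nat.sub_add_cancel (by lia)] at g1
      obtain ⟨t, ht, ht1, ht2⟩ := hE.exists_mem_changePoints hlam.le
        (fun i hi => hY n hn i hi ω) hw0 hw hk' hη (by linarith [hjump n hn k hk])
        (fun v hv => hpen.trans_lt (g1 v hv)) (fun v hv => hpen.trans_lt (g2 v hv))
      refine ⟨t, ht, abs_lt.2 ?_⟩
      -- Integrality improves the distance to at most `w - 1`, which is strictly below `n δ_n / 2`.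
      have ht1' : (cpt n (β n) k : ℝ) + 1 ≤ t + w := by exact_mod_cast ht1
      have ht2' : (t : ℝ) + 1 ≤ cpt n (β n) k + w := by exact_mod_cast ht2
      constructor <;> linarith
    refine (measure_mono hsub).trans ((measure_union_le _ _).trans ?_)
    rw [ae_iff.1 (hest n hn), zero_add]
    refine (measure_biUnion_finset_le _ _).trans ?_
    refine (Finset.sum_le_card_nsmul _ _ (ENNReal.ofReal (2 * (C / (n * δ n / 2))))
      fun k hk => ?_).trans ?_
    · have hk' : k ∈ Finset.Icc 1 (changePoints n (β n)).card := by rwa [hcard]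
      have h1 := one_add_le_cpt hw0 hw hk'
      have h2 := cpt_add_le hw0 hw hk'
      have hnn : 0 ≤ C / (n * δ n / 2) := div_nonneg hC (by linarith)
      rw [two_mul, ENNReal.ofReal_add hnn hnn]
      exact (measure_union_le _ _).trans
        (add_le_add (hbad _ (by lia) (by lia)) (hbad _ (by lia) h2))
    · rw [Nat.card_Icc, Nat.add_sub_cancel, nsmul_eq_mul,
        ENNReal.ofReal_mul (Nat.cast_nonneg _), ENNReal.ofReal_natCast]
  have hlim : Tendsto (fun n : ℕ => ENNReal.ofReal (K * (2 * (C / (n * δ n / 2)))))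
      atTop (𝓝 0) := by
    rw [← ENNReal.ofReal_zero]
    refine ENNReal.tendsto_ofReal ?_
    have : Tendsto (fun n : ℕ => C / (n * δ n / 2)) atTop (𝓝 0) :=
      tendsto_const_nhds.div_atTop (hrate.tendsto_mul_delta.atTop_div_const (by norm_num))
    simpa using (this.const_mul 2).const_mul (K : ℝ)
  exact tendsto_of_tendsto_of_tendsto_of_le_of_le' tendsto_const_nhds hlim
    (Eventually.of_forall fun _ => zero_le) hbound

end QuantileFused

theorem theorem3p1 {Ω : Type*} [MeasurableSpace Ω] (P : Measure Ω) [IsProbabilityMeasure P]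
    (p : ℕ) [NeZero p] (N K : ℕ) (τ : ℝ) (_hτ : 0 < τ ∧ τ < 1)
    (x : ℕ → ℕ → EuclideanSpace ℝ (Fin p))
    (β : ℕ → ℕ → EuclideanSpace ℝ (Fin p))
    (δ lam : ℕ → ℝ)
    (ε : ℕ → Ω → ℝ) (ν : Measure ℝ) [IsProbabilityMeasure ν]
    (_hmeas : ∀ i, Measurable (ε i)) (_hindep : iIndepFun ε P) (_hlaw : ∀ i, P.map (ε i) = ν)
    (Y : ℕ → ℕ → Ω → ℝ)
    (_hY : ∀ n ≥ N, ∀ i ∈ Finset.Icc 1 n, ∀ ω, Y n i ω = inner ℝ (x n i) (β n i) + ε i ω)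
    (_hdesign : QuantileFused.DesignAssumptions N x δ)
    (_herror : QuantileFused.ErrorAssumptions τ ν)
    (_hrate : QuantileFused.RateAssumptions N δ lam)
    (_hchange : QuantileFused.ChangeAssumptions N K τ ν x δ β)
    (βhat : ℕ → Ω → ℕ → EuclideanSpace ℝ (Fin p))
    (_hest : ∀ n ≥ N, ∀ᵐ ω ∂P,
      QuantileFused.IsEstimate τ (lam n) n (x n) (fun i => Y n i ω) (βhat n ω)) :
    Tendsto (fun n : ℕ => P {ω | (QuantileFused.changePoints n (βhat n ω)).card = K ∧
        ¬ ∀ k ∈ Finset.Icc 1 K, |(QuantileFused.cpt n (βhat n ω) k : ℝ)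
          - QuantileFused.cpt n (β n) k| ≤ n * δ n}) atTop (𝓝 0) ∧
    (Tendsto (fun n : ℕ => P {ω | (QuantileFused.changePoints n (βhat n ω)).card = K})
        atTop (𝓝 1) →
      Tendsto (fun n : ℕ => P {ω | ∀ k ∈ Finset.Icc 1 K, |(QuantileFused.cpt n (βhat n ω) k : ℝ)
          - QuantileFused.cpt n (β n) k| ≤ n * δ n}) atTop (𝓝 1)) := by
  have hclose := QuantileFused.tendsto_measure_card_eq_and_not_close _hτ _hmeas _hindep _hlaw _hY
    _hdesign _herror _hrate _hchange _hest
  have hmain : Tendsto (fun n : ℕ => P {ω | (QuantileFused.changePoints n (βhat n ω)).card = K ∧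
      ¬ ∀ k ∈ Finset.Icc 1 K, |(QuantileFused.cpt n (βhat n ω) k : ℝ)
        - QuantileFused.cpt n (β n) k| ≤ n * δ n}) atTop (𝓝 0) := by
    refine tendsto_of_tendsto_of_tendsto_of_le_of_le' tendsto_const_nhds hclose
      (Eventually.of_forall fun _ => zero_le) ?_
    filter_upwards [eventually_ge_atTop N] with n hn
    have hnδ : 0 ≤ n * δ n := mul_nonneg n.cast_nonneg (_hrate.delta_pos n hn).le
    exact measure_mono fun ω hω => ⟨hω.1, fun h => hω.2 fun k hk => (h k hk).le.trans
      (by linarith)⟩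
  exact ⟨hmain, fun hcard => QuantileFused.tendsto_measure_one_of_tendsto_measure_diff hmain hcard⟩
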